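/- Let $d\ge 3$, let $q_1,\dots,q_d$ be positive integers whose greatest common factor is $1$, and let $V:\mathbb{Z}^d\to\mathbb{C}$ be periodic with respect to $\Gamma=q_1\mathbb{Z}\oplus\cdots\oplus q_d\mathbb{Z}$, that is, $V(n+\gamma)=V(n)$ for all $n\in\mathbb{Z}^d$ and $\gamma\in\Gamma$. Let $W=\{n\in\mathbb{Z}^d: 0\le n_j\le q_j-1,\ j=1,\dots,d\}$ and $Q=q_1q_2\cdots q_d$. For $z=(z_1,\dots,z_d)\in(\mathbb{C}\setminus\{0\})^d$, let $\mathcal{D}(z)$ be the $Q\times Q$ matrix of the operator $-\Delta+V$, where $(\Delta u)(n)=\sum_{\|n'-n\|_1=1}u(n')$, acting on functions $u:W\to\mathbb{C}$ that are extended to $\mathbb{Z}^d$ by the Floquet condition $u(n+q_j\mathbf{e}_j)=z_ju(n)$ for $n\in\mathbb{Z}^d$, $j=1,\dots,d$ (with $\mathbf{e}_1,\dots,\mathbf{e}_d$ the standard basis of $\mathbb{Z}^d$). Let $\mathcal{P}(z,\lambda)=\det(\mathcal{D}(z)-\lambda I)$, which is a Laurent polynomial in $z_1,\dots,z_d$ for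 each fixed $\lambda$. Then for every $\lambda\in\mathbb{C}$ the Laurent polynomial $\mathcal{P}(z,\lambda)$, as a function of $z$, is irreducible in the following sense: there are no Laurent polynomials $f$ and $g$ in $z_1,\dots,z_d$ with complex coefficients, neither of which is a monomial, such that $\mathcal{P}(\cdot,\lambda)=fg$. Here a monomial is a Laurent polynomial of the form $Cz_1^{a_1}\cdots z_d^{a_d}$ with $C\in\mathbb{C}\setminus\{0\}$ and $a_1,\dots,a_d\in\mathbb{Z}$. -/

import Mathlib

noncomputable section

/-- Laurent polynomials over `ℂ` in the variables `z_1, …, z_d`; the basis element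
`AddMonoidAlgebra.single a 1` is `z ^ a = z_1 ^ a_1 ⋯ z_d ^ a_d`, for `a ∈ ℤ ^ d`. -/
abbrev LaurentPoly (d : ℕ) : Type := AddMonoidAlgebra ℂ (Fin d → ℤ)

/-- The power product `z ^ a`. -/
def zpowMon {d : ℕ} (a : Fin d → ℤ) : LaurentPoly d := AddMonoidAlgebra.single a 1

/-- A monomial: a single term `C z ^ a` with `C ≠ 0`. -/
def IsLaurentMonomial {d : ℕ} (f : LaurentPoly d) : Prop :=
  ∃ (a : Fin d → ℤ) (C : ℂ), C ≠ 0 ∧ f = AddMonoidAlgebra.single a C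

/-- Irreducibility of a Laurent polynomial: there is no factorization into two Laurent polynomials
neither of which is a monomial. -/
def IsLaurentIrreducible {d : ℕ} (h : LaurentPoly d) : Prop :=
  ¬ ∃ f g : LaurentPoly d, ¬ IsLaurentMonomial f ∧ ¬ IsLaurentMonomial g ∧ h = f * g

/-- Periodicity with respect to the lattice `Γ = q_1 ℤ ⊕ ⋯ ⊕ q_d ℤ`. -/
def IsLatticePeriodic {d : ℕ} (q : Fin d → ℕ) (V : (Fin d → ℤ) → ℂ) : Prop :=
  ∀ γ : Fin d → ℤ, (∀ j, (q j : ℤ) ∣ γ j) → ∀ n, V (n + γ) = V n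

/-- The discrete Laplacian: the sum over the `2 d` neighbours `n ± e_j` of `n` in `ℤ ^ d`, which are
the points at `ℓ¹`-distance one. It acts on functions with values in any abelian group. -/
def discreteLaplacian {d : ℕ} {M : Type*} [AddCommGroup M] (u : (Fin d → ℤ) → M) :
    (Fin d → ℤ) → M :=
  fun n => ∑ j : Fin d, (u (n + Pi.single j 1) + u (n - Pi.single j 1))

/-- The discrete Schrödinger operator `-Δ + V`. -/
def schrodingerOp {d : ℕ} {M : Type*} [AddCommGroup M] [Module ℂ M] (V : (Fin d → ℤ) → ℂ)
    (u : (Fin d → ℤ) → M) : (Fin d → ℤ) → M :=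
  fun n => - discreteLaplacian u n + V n • u n

/-- The fundamental domain `W = {n : 0 ≤ n_j ≤ q_j - 1}`, which has `Q = q_1 ⋯ q_d` points. -/
abbrev FundCell {d : ℕ} (q : Fin d → ℕ) : Type := ∀ j : Fin d, Fin (q j)

/-- A point of the fundamental domain as a point of `ℤ ^ d`. -/
def cellPoint {d : ℕ} {q : Fin d → ℕ} (n : FundCell q) : Fin d → ℤ := fun j => ((n j : ℕ) : ℤ)

/-- The extension of `u : W → M` to `ℤ ^ d` by the Floquet condition `u (n + q_j e_j) = z_j u (n)`,
the `z_j` being the variables of the Laurent polynomial ring `M`: if `m = n + ∑ j, a_j q_j e_j` with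
`n ∈ W` then its value at `m` is `z ^ a u (n)`. -/
def floquetExtension {d : ℕ} (q : Fin d → ℕ) (u : FundCell q → LaurentPoly d) :
    (Fin d → ℤ) → LaurentPoly d :=
  fun m => ∑ n : FundCell q,
    if ∀ j, (q j : ℤ) ∣ m j - cellPoint n j then
      zpowMon (fun j => (m j - cellPoint n j) / (q j : ℤ)) * u n
    else 0

/-- The `Q × Q` matrix `𝒟(z)` of the operator `-Δ + V` acting on functions on `W` through the
Floquet condition: its column `n'` is the image of the indicator function of `n'`. -/
def floquetMatrix {d : ℕ} (q : Fin d → ℕ) (V : (Fin d → ℤ) → ℂ) :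
    Matrix (FundCell q) (FundCell q) (LaurentPoly d) :=
  Matrix.of fun n n' => schrodingerOp V (floquetExtension q (Pi.single n' 1)) (cellPoint n)

/-- The Laurent polynomial `𝒫(z, lam) = det (𝒟(z) - lam I)` in `z`, for a given number `lam`. -/
def floquetDet {d : ℕ} (q : Fin d → ℕ) (V : (Fin d → ℤ) → ℂ) (lam : ℂ) : LaurentPoly d :=
  (floquetMatrix q V - lam • (1 : Matrix (FundCell q) (FundCell q) (LaurentPoly d))).det

end

noncomputable section

/-! Substitute `z_j = w_j ^ (q_j)` and conjugate by the diagonal matrix of the `w ^ n`. Hops then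
carry a single factor `w_j` or `w_j⁻¹`, while the potential and `lam` have degree zero. For a sign
pattern `ε`, the part of the determinant of maximal `ε`-weight therefore ignores the potential. The
discrete Fourier transform diagonalizes it and gives a product of `Q` linear forms in the `w_j ^
(ε_j)` (`det_leadingMatrix`).

These forms are prime, and pairwise non-associate because the periods have greatest common factor
`1`. Multiplying each `w_j` by a `q_j`-th root of unity permutes them transitively and fixes every
polynomial in the `w_j ^ (q_j)`. Hence, if the determinant is `F * G` with both factors obtained by
the substitution, a factor whose leading part is divisible by one form is divisible there by all,
and the other leading part is a unit, that is, a monomial (`isUnit_or_isUnit_of_mul_eq`).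

The Newton polytope of the determinant is the cross-polytope with vertices `± Q e_k`, and on each
facet one factor contributes a single point. Adjacent facets share `d - 1 ≥ 2` vertices, so the same
factor contributes the same point on the neighbouring facet. It does so on all facets, and this
factor is a monomial (`isLaurentMonomial_of_isUniqueMax`). -/

variable {d : ℕ}

/-! ### Weights and leading parts of Laurent polynomials. -/

/-- The part of a Laurent polynomial consisting of the terms of weight `n`, where `z ^ a` has weight
`c ⬝ᵥ a`. -/
def weightPart (c : Fin d → ℤ) (n : ℤ) : LaurentPoly d →ₗ[ℂ] LaurentPoly d where
  toFun f := .ofCoeff (f.coeff.filter fun a => c ⬝ᵥ a = n)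
  map_add' f g := by ext; simp [Finsupp.filter_add]
  map_smul' r f := by ext; simp [Finsupp.filter_smul]

/-- All terms of `f` have weight at most `n`. -/
def WeightLE (c : Fin d → ℤ) (n : ℤ) (f : LaurentPoly d) : Prop :=
  ∀ a, f.coeff a ≠ 0 → c ⬝ᵥ a ≤ n

theorem coeff_weightPart (c : Fin d → ℤ) (n : ℤ) (f : LaurentPoly d) (a : Fin d → ℤ) :
    (weightPart c n f).coeff a = if c ⬝ᵥ a = n then f.coeff a else 0 := by
  simp [weightPart, Finsupp.filter_apply]

theorem weightPart_single (c : Fin d → ℤ) (n : ℤ) (a : Fin d → ℤ) (r : ℂ) :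
    weightPart c n (.single a r) = if c ⬝ᵥ a = n then .single a r else 0 := by
  ext b
  rw [coeff_weightPart]
  by_cases h : a = b
  · subst h; split_ifs <;> simp
  · split_ifs <;> simp [h]

theorem WeightLE.weightPart_eq_zero {c : Fin d → ℤ} {m n : ℤ} {f : LaurentPoly d}
    (h : WeightLE c m f) (hmn : m < n) : weightPart c n f = 0 := by
  ext a
  rw [coeff_weightPart]
  split_ifs with ha
  · by_contra h0
    have := h a h0
    lia
  · rfl

theorem WeightLE.zero (c : Fin d → ℤ) (n : ℤ) : WeightLE c n 0 := fun _ h => absurd rfl h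

theorem WeightLE.add {c : Fin d → ℤ} {n : ℤ} {f g : LaurentPoly d} (hf : WeightLE c n f)
    (hg : WeightLE c n g) : WeightLE c n (f + g) := fun a h => by
  by_cases h0 : f.coeff a = 0
  · exact hg a fun h1 => h (by simp [h0, h1])
  · exact hf a h0

theorem WeightLE.neg {c : Fin d → ℤ} {n : ℤ} {f : LaurentPoly d} (hf : WeightLE c n f) :
    WeightLE c n (-f) := fun a h => hf a fun h0 => h (by simp [h0])

theorem WeightLE.sum {ι : Type*} {c : Fin d → ℤ} {n : ℤ} {s : Finset ι} {f : ι → LaurentPoly d}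
    (hf : ∀ i ∈ s, WeightLE c n (f i)) : WeightLE c n (∑ i ∈ s, f i) :=
  Finset.sum_induction _ _ (fun _ _ => WeightLE.add) (WeightLE.zero c n) hf

theorem WeightLE.single {c : Fin d → ℤ} {n : ℤ} {a : Fin d → ℤ} (h : c ⬝ᵥ a ≤ n) (r : ℂ) :
    WeightLE c n (AddMonoidAlgebra.single a r) := fun b hb => by
  by_cases hab : a = b
  · exact hab ▸ h
  · simp [hab] at hb

theorem exists_coeff_of_mul {f g : LaurentPoly d} {a : Fin d → ℤ} (h : (f * g).coeff a ≠ 0) :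
    ∃ b b', f.coeff b ≠ 0 ∧ g.coeff b' ≠ 0 ∧ b + b' = a := by
  classical
  have := AddMonoidAlgebra.support_coeff_mul_subset f g (Finsupp.mem_support_iff.2 h)
  obtain ⟨b, hb, b', hb', e⟩ := Finset.mem_add.1 this
  exact ⟨b, b', Finsupp.mem_support_iff.1 hb, Finsupp.mem_support_iff.1 hb', e⟩

theorem WeightLE.mul {c : Fin d → ℤ} {m n : ℤ} {f g : LaurentPoly d} (hf : WeightLE c m f)
    (hg : WeightLE c n g) : WeightLE c (m + n) (f * g) := fun a h => by
  obtain ⟨b, b', hb, hb', rfl⟩ := exists_coeff_of_mul h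
  rw [dotProduct_add]
  exact add_le_add (hf b hb) (hg b' hb')

theorem weightLE_weightPart (c : Fin d → ℤ) (n : ℤ) (f : LaurentPoly d) :
    WeightLE c n (weightPart c n f) := fun a h => by
  rw [coeff_weightPart] at h
  split_ifs at h with h0
  · exact h0.le
  · exact absurd rfl h

theorem WeightLE.sub_weightPart {c : Fin d → ℤ} {n : ℤ} {f : LaurentPoly d} (hf : WeightLE c n f) :
    WeightLE c (n - 1) (f - weightPart c n f) := fun a h => by
  rw [AddMonoidAlgebra.coeff_sub, Finsupp.sub_apply, coeff_weightPart] at h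
  split_ifs at h with h0
  · simp at h
  · have := hf a (by simpa using h)
    lia

theorem weightPart_mul_weightPart (c : Fin d → ℤ) (m n : ℤ) (f g : LaurentPoly d) :
    weightPart c (m + n) (weightPart c m f * weightPart c n g) =
      weightPart c m f * weightPart c n g := by
  ext a
  rw [coeff_weightPart]
  split_ifs with h
  · rfl
  · by_contra h0
    obtain ⟨b, b', hb, hb', rfl⟩ := exists_coeff_of_mul (Ne.symm h0)
    rw [coeff_weightPart] at hb hb'
    rw [dotProduct_add] at h
    grind

/-- Replacing either factor by its remainder below the top weight lowers the weight of the product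
by at least one, so only the product of the two top parts survives. The top parts are allowed to
vanish. -/
theorem WeightLE.weightPart_mul {c : Fin d → ℤ} {m n : ℤ} {f g : LaurentPoly d}
    (hf : WeightLE c m f) (hg : WeightLE c n g) :
    weightPart c (m + n) (f * g) = weightPart c m f * weightPart c n g := by
  have e : f * g = weightPart c m f * weightPart c n g +
      ((f - weightPart c m f) * g + weightPart c m f * (g - weightPart c n g)) := by ring
  have h : WeightLE c (m + n - 1)
      ((f - weightPart c m f) * g + weightPart c m f * (g - weightPart c n g)) := by
    refine WeightLE.add ?_ ?_
    · convert hf.sub_weightPart.mul hg using 1; ring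
    · convert (weightLE_weightPart c m f).mul hg.sub_weightPart using 1; ring
  rw [e, map_add, h.weightPart_eq_zero (by lia), add_zero, weightPart_mul_weightPart]

theorem weightLE_and_weightPart_prod {ι : Type*} {c : Fin d → ℤ} (s : Finset ι)
    {f : ι → LaurentPoly d} (hf : ∀ i ∈ s, WeightLE c 1 (f i)) :
    WeightLE c s.card (∏ i ∈ s, f i) ∧
      weightPart c s.card (∏ i ∈ s, f i) = ∏ i ∈ s, weightPart c 1 (f i) := by
  classical
  induction s using Finset.induction_on with
  | empty =>
    have h : (1 : LaurentPoly d) = .single 0 1 := rfl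
    simp only [Finset.prod_empty, Finset.card_empty, h]
    exact ⟨WeightLE.single (by simp) 1, by simp [weightPart_single]⟩
  | insert i s hi ih =>
    obtain ⟨h1, h2⟩ := ih fun j hj => hf j (Finset.mem_insert_of_mem hj)
    have h3 := hf i (Finset.mem_insert_self i s)
    rw [Finset.prod_insert hi, Finset.prod_insert hi, Finset.card_insert_of_notMem hi]
    push_cast
    rw [add_comm (s.card : ℤ)]
    exact ⟨h3.mul h1, by rw [h3.weightPart_mul h1, h2]⟩

/-- Each term of the Leibniz expansion is a product of `Fintype.card ι` entries of weight at most
one, so the product rule for top parts applies term by term. -/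
theorem weightLE_and_weightPart_det {ι : Type*} [Fintype ι] [DecidableEq ι] {c : Fin d → ℤ}
    {M : Matrix ι ι (LaurentPoly d)} (hM : ∀ i j, WeightLE c 1 (M i j)) :
    WeightLE c (Fintype.card ι) M.det ∧
      weightPart c (Fintype.card ι) M.det = (M.map (weightPart c 1)).det := by
  have h := fun σ : Equiv.Perm ι =>
    weightLE_and_weightPart_prod Finset.univ fun i (_ : i ∈ Finset.univ) => hM (σ i) i
  rw [Matrix.det_apply, Matrix.det_apply]
  constructor
  · refine WeightLE.sum fun σ _ => ?_
    rcases Int.units_eq_one_or (Equiv.Perm.sign σ) with e | e <;> rw [e]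
    · simpa using (h σ).1
    · simpa using (h σ).1.neg
  · rw [map_sum]
    refine Finset.sum_congr rfl fun σ _ => ?_
    rcases Int.units_eq_one_or (Equiv.Perm.sign σ) with e | e <;> rw [e]
    · simpa using (h σ).2
    · simpa using (h σ).2

theorem exists_weight_max (c : Fin d → ℤ) {f : LaurentPoly d} (hf : f ≠ 0) :
    ∃ n, WeightLE c n f ∧ weightPart c n f ≠ 0 := by
  have hs : f.coeff.support.Nonempty := by
    rw [Finsupp.support_nonempty_iff]; simpa using hf
  obtain ⟨a, ha, h⟩ := Finset.exists_max_image _ (fun a => c ⬝ᵥ a) hs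
  refine ⟨c ⬝ᵥ a, fun b hb => h b (Finsupp.mem_support_iff.2 hb), fun h0 => ?_⟩
  have := congrArg (fun p => p.coeff a) h0
  rw [coeff_weightPart, if_pos rfl] at this
  exact Finsupp.mem_support_iff.1 ha this

/-! ### Units, and products of distinct primes. -/

/-- If the supports of `f` and its inverse were not both singletons, `TwoUniqueSums` would give two
different pairs of exponents whose sums are attained only once. Both sums then have nonzero
coefficient in `f * g = 1`, so both are `0`, against uniqueness. -/
theorem IsUnit.isLaurentMonomial {f : LaurentPoly d} (hf : IsUnit f) : IsLaurentMonomial f := by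
  classical
  obtain ⟨g, hg⟩ := hf.exists_right_inv
  have hf0 : f ≠ 0 := hf.ne_zero
  have hg0 : g ≠ 0 := fun h => by simp [h] at hg
  have hfs : 0 < f.coeff.support.card := by
    rw [Finset.card_pos, Finsupp.support_nonempty_iff]; simpa using hf0
  have hgs : 0 < g.coeff.support.card := by
    rw [Finset.card_pos, Finsupp.support_nonempty_iff]; simpa using hg0
  have key : f.coeff.support.card * g.coeff.support.card ≤ 1 := by
    by_contra! h
    obtain ⟨p, hp, p', hp', hne, hu, hu'⟩ := TwoUniqueSums.uniqueAdd_of_one_lt_card h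
    rw [Finset.mem_product] at hp hp'
    have aux : ∀ p : (Fin d → ℤ) × (Fin d → ℤ), p.1 ∈ f.coeff.support → p.2 ∈ g.coeff.support →
        UniqueAdd f.coeff.support g.coeff.support p.1 p.2 → p.1 + p.2 = 0 := by
      intro p h1 h2 hu
      have := AddMonoidAlgebra.coeff_mul_add_of_uniqueAdd hu
      by_contra h0
      rw [hg, AddMonoidAlgebra.one_def, AddMonoidAlgebra.coeff_single, Finsupp.single_apply,
        if_neg (Ne.symm h0)] at this
      exact mul_ne_zero (Finsupp.mem_support_iff.1 h1) (Finsupp.mem_support_iff.1 h2) this.symm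
    have h1 := aux p hp.1 hp.2 hu
    have h2 := aux p' hp'.1 hp'.2 hu'
    have := hu hp'.1 hp'.2 (by rw [h1, h2])
    exact hne (Prod.ext this.1.symm this.2.symm)
  have h1 : f.coeff.support.card = 1 := by nlinarith
  obtain ⟨a, b, hb, e⟩ := Finsupp.card_support_eq_one'.1 h1
  exact ⟨a, b, hb, by ext1; simpa using e⟩

theorem Finset.prod_dvd_of_prime_of_not_dvd {ι M : Type*} [CommMonoidWithZero M] [IsCancelMulZero M]
    {s : Finset ι} {p : ι → M} {n : M} (hp : ∀ i ∈ s, Prime (p i)) (hn : ∀ i ∈ s, p i ∣ n)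
    (h : ∀ i ∈ s, ∀ j ∈ s, p i ∣ p j → i = j) : ∏ i ∈ s, p i ∣ n := by
  classical
  induction s using Finset.induction_on generalizing n with
  | empty => simp
  | insert i s hi ih =>
    rw [Finset.prod_insert hi]
    obtain ⟨k, rfl⟩ := hn i (Finset.mem_insert_self i s)
    refine mul_dvd_mul_left _ (ih (fun j hj => hp j (Finset.mem_insert_of_mem hj)) ?_
      fun j hj k hk => h j (Finset.mem_insert_of_mem hj) k (Finset.mem_insert_of_mem hk))
    intro j hj
    refine ((hp j (Finset.mem_insert_of_mem hj)).dvd_or_dvd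
      (hn j (Finset.mem_insert_of_mem hj))).resolve_left fun hd => hi ?_
    exact h j (Finset.mem_insert_of_mem hj) i (Finset.mem_insert_self i s) hd ▸ hj

/-! ### Primality of linear forms, through a generic point of the hyperplane. -/

/-- The linear form `∑ j, ρ_j z_j ^ (ε_j)`, for signs `ε_j`. -/
def linForm (ρ : Fin d → ℂ) (ε : Fin d → ℤˣ) : LaurentPoly d :=
  ∑ j, AddMonoidAlgebra.single (Pi.single j (ε j : ℤ)) (ρ j)

/-- Evaluation of Laurent polynomials at a point with nonzero coordinates. -/
def laurentEval {K : Type*} [Field K] [Algebra ℂ K] (v : Fin d → K) (hv : ∀ j, v j ≠ 0) :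
    LaurentPoly d →ₐ[ℂ] K :=
  AddMonoidAlgebra.lift ℂ K (Fin d → ℤ)
    { toFun := fun a => ∏ j, v j ^ (a.toAdd j)
      map_one' := by simp
      map_mul' := fun a b => by
        rw [← Finset.prod_mul_distrib]
        exact Finset.prod_congr rfl fun j _ => zpow_add₀ (hv j) _ _ }

theorem laurentEval_single {K : Type*} [Field K] [Algebra ℂ K] (v : Fin d → K) (hv : ∀ j, v j ≠ 0)
    (a : Fin d → ℤ) (r : ℂ) :
    laurentEval v hv (.single a r) = r • ∏ j, v j ^ a j := by
  simp [laurentEval]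


/-- Monomials are units, so their images define a homomorphism from the exponent group to `Kˣ`,
determined by its values on the basis. -/
theorem AlgHom.map_laurent_single {K : Type*} [Field K] [Algebra ℂ K] (φ : LaurentPoly d →ₐ[ℂ] K)
    (a : Fin d → ℤ) (r : ℂ) :
    φ (.single a r) = r • ∏ j, φ (.single (Pi.single j 1) 1) ^ a j := by
  have h1 : (AddMonoidAlgebra.single a r : LaurentPoly d) = r • .single a 1 := by simp
  rw [h1, map_smul]
  congr 1
  let g : Multiplicative (Fin d → ℤ) →* Kˣ :=
    ((φ : LaurentPoly d →* K).comp (AddMonoidAlgebra.of ℂ (Fin d → ℤ))).toHomUnits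
  have hg : ∀ b : Fin d → ℤ, ((g (.ofAdd b) : Kˣ) : K) = φ (.single b 1) := fun b => by
    simp [g]
  have ha : Multiplicative.ofAdd a = ∏ j, Multiplicative.ofAdd (Pi.single j (1 : ℤ)) ^ a j := by
    apply Multiplicative.toAdd.injective
    rw [toAdd_prod]
    simp only [toAdd_zpow, toAdd_ofAdd]
    ext i
    simp [Finset.sum_apply, Pi.single_apply]
  rw [← hg, ha, map_prod, Units.coe_prod]
  refine Finset.prod_congr rfl fun j _ => ?_
  rw [map_zpow, Units.val_zpow_eq_zpow_val, hg]

/-- The value of the `k`-th variable `z_k ^ (ε_k)` on the hyperplane `linForm ρ ε = 0`. -/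
def linFormRoot (ρ : Fin d → ℂ) (ε : Fin d → ℤˣ) (k : Fin d) : LaurentPoly d :=
  ∑ j ∈ Finset.univ.erase k, .single (Pi.single j (ε j : ℤ)) (-(ρ k)⁻¹ * ρ j)

theorem linForm_eq (ρ : Fin d → ℂ) (hρ : ∀ j, ρ j ≠ 0) (ε : Fin d → ℤˣ) (k : Fin d) :
    linForm ρ ε = ρ k • (AddMonoidAlgebra.single (Pi.single k (ε k : ℤ)) 1 - linFormRoot ρ ε k) := by
  rw [linForm, ← Finset.add_sum_erase _ _ (Finset.mem_univ k), linFormRoot, smul_sub, sub_eq_add_neg]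
  congr 1
  · simp
  · rw [Finset.smul_sum, ← Finset.sum_neg_distrib]
    refine Finset.sum_congr rfl fun j _ => ?_
    ext
    simp [hρ k]

theorem piSingle_units_inj {ε : Fin d → ℤˣ} {i j : Fin d}
    (h : (Pi.single i (ε i : ℤ) : Fin d → ℤ) = Pi.single j (ε j : ℤ)) : i = j := by
  by_contra hij
  have := congrFun h i
  simp [hij] at this

theorem coeff_sum_piSingle (s : Finset (Fin d)) (ε : Fin d → ℤˣ) (c : Fin d → ℂ) {i : Fin d}
    (hi : i ∈ s) : (∑ j ∈ s, AddMonoidAlgebra.single (Pi.single j (ε j : ℤ)) (c j) :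
      LaurentPoly d).coeff (Pi.single i (ε i : ℤ)) = c i := by
  rw [AddMonoidAlgebra.coeff_sum, Finsupp.finsetSum_apply, Finset.sum_eq_single i]
  · simp
  · intro j _ hji
    rw [AddMonoidAlgebra.coeff_single, Finsupp.single_apply,
      if_neg fun h => hji (piSingle_units_inj h)]
  · exact fun h => absurd hi h

theorem linFormRoot_ne_zero (hd : 2 ≤ d) (ρ : Fin d → ℂ) (hρ : ∀ j, ρ j ≠ 0) (ε : Fin d → ℤˣ)
    (k : Fin d) : linFormRoot ρ ε k ≠ 0 := by
  intro h0
  have : Nontrivial (Fin d) := Fin.nontrivial_iff_two_le.2 hd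
  obtain ⟨j, hj⟩ := exists_ne k
  have := congrArg (fun p => p.coeff (Pi.single j (ε j : ℤ))) h0
  rw [linFormRoot, coeff_sum_piSingle _ _ _ (by simpa using hj)] at this
  simp [hρ] at this

/-- A point of the hyperplane `linForm ρ ε = 0` that is generic, with coordinates in the fraction
field of the ring of Laurent polynomials. -/
theorem exists_generic_point (hd : 2 ≤ d) (ρ : Fin d → ℂ) (hρ : ∀ j, ρ j ≠ 0) (ε : Fin d → ℤˣ)
    (k : Fin d) : ∃ π : LaurentPoly d →ₐ[ℂ] FractionRing (LaurentPoly d),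
      (∀ a r, a k = 0 → π (.single a r) = algebraMap _ _ (AddMonoidAlgebra.single a r)) ∧
      π (.single (Pi.single k (ε k : ℤ)) 1) = algebraMap _ _ (linFormRoot ρ ε k) := by
  classical
  let ι : LaurentPoly d →ₐ[ℂ] FractionRing (LaurentPoly d) :=
    IsScalarTower.toAlgHom ℂ (LaurentPoly d) _
  have hι : Function.Injective ι := IsFractionRing.injective _ _
  have hr : ι (linFormRoot ρ ε k) ≠ 0 :=
    (map_ne_zero_iff ι hι).2 (linFormRoot_ne_zero hd ρ hρ ε k)
  -- The exponent `ε k` on the root makes the `k`-th variable to the power `ε k` equal to the root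
  -- itself, since `ε k * ε k = 1`.
  let v : Fin d → FractionRing (LaurentPoly d) :=
    Function.update (fun j => ι (.single (Pi.single j 1) 1)) k
      (ι (linFormRoot ρ ε k) ^ (ε k : ℤ))
  have hv : ∀ j, v j ≠ 0 := fun j => by
    by_cases hj : j = k
    · subst hj
      simpa [v] using zpow_ne_zero _ hr
    · simp only [v, Function.update_of_ne hj]
      exact (map_ne_zero_iff ι hι).2 (AddMonoidAlgebra.single_ne_zero.2 one_ne_zero)
  refine ⟨laurentEval v hv, fun a r ha => ?_, ?_⟩
  · change _ = ι _
    rw [laurentEval_single, AlgHom.map_laurent_single]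
    congr 1
    refine Finset.prod_congr rfl fun j _ => ?_
    by_cases hj : j = k
    · subst hj; simp [ha]
    · simp only [v, Function.update_of_ne hj]
  · change _ = ι _
    rw [laurentEval_single, one_smul, Finset.prod_eq_single k]
    · simp only [v, Function.update_self, Pi.single_eq_same]
      rw [← zpow_mul, ← Units.val_mul, Int.units_mul_self, Units.val_one, zpow_one]
    · intro j _ hj
      simp [hj]
    · simp

theorem single_piSingle_pow (k : Fin d) (u : ℤ) (n : ℕ) :
    (AddMonoidAlgebra.single (Pi.single k u) 1 : LaurentPoly d) ^ n =
      .single (Pi.single k (n * u)) 1 := by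
  rw [AddMonoidAlgebra.single_pow, one_pow, ← Pi.single_smul, nsmul_eq_mul]

/-- Division with remainder by `X - r`, where `X = z_k ^ (ε_k)`: a power of `X` clears negative
exponents, after which `X` may be replaced by `r`. The remainder `g` is unchanged by `π`, so `π g =
0` will force `g = 0` when `ι` is injective. -/
theorem exists_dvd_pow_mul_sub {K : Type*} [Field K] [Algebra ℂ K] {ε : Fin d → ℤˣ} {k : Fin d}
    {ι π : LaurentPoly d →ₐ[ℂ] K} {r : LaurentPoly d} (hr : π r = ι r)
    (h : ∀ a c, a k = 0 → π (.single a c) = ι (.single a c)) (f : LaurentPoly d) :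
    ∃ (N : ℕ) (g : LaurentPoly d), π g = ι g ∧
      (AddMonoidAlgebra.single (Pi.single k (ε k : ℤ)) 1 - r) ∣
        AddMonoidAlgebra.single (Pi.single k (ε k : ℤ)) 1 ^ N * f - g := by
  induction f using AddMonoidAlgebra.induction_linear with
  | zero => exact ⟨0, 0, by simp, by simp⟩
  | add f₁ f₂ h₁ h₂ =>
    obtain ⟨N₁, g₁, e₁, d₁⟩ := h₁
    obtain ⟨N₂, g₂, e₂, d₂⟩ := h₂
    set X : LaurentPoly d := .single (Pi.single k (ε k : ℤ)) 1
    refine ⟨N₁ + N₂, r ^ N₂ * g₁ + r ^ N₁ * g₂, by simp [e₁, e₂, hr], ?_⟩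
    have key : X ^ (N₁ + N₂) * (f₁ + f₂) - (r ^ N₂ * g₁ + r ^ N₁ * g₂) =
        X ^ N₂ * (X ^ N₁ * f₁ - g₁) + (X ^ N₂ - r ^ N₂) * g₁ +
        (X ^ N₁ * (X ^ N₂ * f₂ - g₂) + (X ^ N₁ - r ^ N₁) * g₂) := by ring
    rw [key]
    exact dvd_add (dvd_add (d₁.mul_left _) ((sub_dvd_pow_sub_pow X r N₂).mul_right _))
      (dvd_add (d₂.mul_left _) ((sub_dvd_pow_sub_pow X r N₁).mul_right _))
  | single a c =>
    have hu : (ε k : ℤ) * ε k = 1 := by rw [← Units.val_mul, Int.units_mul_self, Units.val_one]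
    -- This is the exponent of `X` after clearing; it equals `0` or `2 * |a k|`.
    have hN : 0 ≤ ((a k).natAbs : ℤ) + ε k * a k := by
      rcases Int.units_eq_one_or (ε k) with e | e <;> rw [e] <;> push_cast <;> grind
    obtain ⟨m, hm⟩ := Int.eq_ofNat_of_zero_le hN
    refine ⟨(a k).natAbs, r ^ m * .single (Function.update a k 0) c, ?_, ?_⟩
    · rw [map_mul, map_mul, map_pow, map_pow, hr, h _ _ (by simp)]
    · have key : (AddMonoidAlgebra.single (Pi.single k (ε k : ℤ)) 1 : LaurentPoly d) ^ (a k).natAbs *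
          .single a c = .single (Pi.single k (ε k : ℤ)) 1 ^ m * .single (Function.update a k 0) c := by
        rw [single_piSingle_pow, single_piSingle_pow, AddMonoidAlgebra.single_mul_single,
          AddMonoidAlgebra.single_mul_single]
        congr 1
        ext j
        by_cases hj : j = k
        · subst hj
          simp only [Pi.add_apply, Pi.single_eq_same, Function.update_self, ← hm]
          linear_combination -(a j) * hu
        · simp [hj]
      rw [key, ← sub_mul]
      exact (sub_dvd_pow_sub_pow _ _ m).mul_right _

/-- The kernel of evaluation at the generic point is generated by the linear form. As the target is
a field, primality follows. -/
theorem linForm_dvd_iff_of_generic {ρ : Fin d → ℂ} (hρ : ∀ j, ρ j ≠ 0) {ε : Fin d → ℤˣ} {k : Fin d}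
    {π : LaurentPoly d →ₐ[ℂ] FractionRing (LaurentPoly d)}
    (h : ∀ a r, a k = 0 → π (.single a r) = algebraMap _ _ (AddMonoidAlgebra.single a r))
    (hk : π (.single (Pi.single k (ε k : ℤ)) 1) = algebraMap _ _ (linFormRoot ρ ε k))
    (f : LaurentPoly d) : linForm ρ ε ∣ f ↔ π f = 0 := by
  let ι : LaurentPoly d →ₐ[ℂ] FractionRing (LaurentPoly d) :=
    IsScalarTower.toAlgHom ℂ (LaurentPoly d) _
  have hι : Function.Injective ι := IsFractionRing.injective _ _
  have hr : π (linFormRoot ρ ε k) = ι (linFormRoot ρ ε k) := by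
    rw [linFormRoot, map_sum, map_sum]
    exact Finset.sum_congr rfl fun j hj => h _ _ (by simp [(Finset.ne_of_mem_erase hj).symm])
  have hL : π (linForm ρ ε) = 0 := by
    rw [linForm_eq ρ hρ ε k, map_smul, map_sub, hk, hr]
    exact (congrArg _ (sub_self _)).trans (smul_zero _)
  constructor
  · rintro ⟨g, rfl⟩
    rw [map_mul, hL, zero_mul]
  · intro hf
    obtain ⟨N, g, hg, hdvd⟩ := exists_dvd_pow_mul_sub (ε := ε) (ι := ι) hr h f
    have hLd : linForm ρ ε ∣ AddMonoidAlgebra.single (Pi.single k (ε k : ℤ)) 1 ^ N * f - g := by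
      refine dvd_trans ?_ hdvd
      refine ⟨algebraMap ℂ _ (ρ k)⁻¹, ?_⟩
      rw [linForm_eq ρ hρ ε k, mul_comm, ← Algebra.smul_def, smul_smul, inv_mul_cancel₀ (hρ k),
        one_smul]
    have hg0 : g = 0 := by
      obtain ⟨t, ht⟩ := hLd
      have := congrArg π ht
      rw [map_sub, map_mul, hf, mul_zero, map_mul, hL, zero_mul, zero_sub, neg_eq_zero, hg] at this
      exact (map_eq_zero_iff ι hι).1 this
    rw [hg0, sub_zero] at hLd
    have hunit : IsUnit ((AddMonoidAlgebra.single (Pi.single k (ε k : ℤ)) 1 : LaurentPoly d) ^ N) := by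
      refine IsUnit.pow N (IsUnit.of_mul_eq_one (.single (-Pi.single k (ε k : ℤ)) 1) ?_)
      rw [AddMonoidAlgebra.single_mul_single, add_neg_cancel, one_mul, AddMonoidAlgebra.one_def]
    exact (hunit.dvd_mul_left).1 hLd

theorem prime_linForm (hd : 2 ≤ d) {ρ : Fin d → ℂ} (hρ : ∀ j, ρ j ≠ 0) (ε : Fin d → ℤˣ) :
    Prime (linForm ρ ε) := by
  let k : Fin d := ⟨0, by lia⟩
  obtain ⟨π, h, hk⟩ := exists_generic_point hd ρ hρ ε k
  have hdvd := linForm_dvd_iff_of_generic hρ h hk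
  refine ⟨fun h0 => ?_, fun hu => ?_, fun f g hfg => ?_⟩
  · have := congrArg (fun p => p.coeff (Pi.single k (ε k : ℤ))) h0
    rw [linForm, coeff_sum_piSingle _ _ _ (Finset.mem_univ k)] at this
    exact hρ k this
  · have := (hdvd 1).1 hu.dvd
    rw [map_one] at this
    exact one_ne_zero this
  · rw [hdvd, map_mul, mul_eq_zero] at hfg
    rwa [hdvd, hdvd]

theorem proportional_of_linForm_dvd (hd : 2 ≤ d) {ρ ρ' : Fin d → ℂ} (hρ : ∀ j, ρ j ≠ 0)
    {ε : Fin d → ℤˣ} (hdvd : linForm ρ ε ∣ linForm ρ' ε) : ∃ c : ℂ, ∀ j, ρ' j = c * ρ j := by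
  let k : Fin d := ⟨0, by lia⟩
  obtain ⟨π, h, hk⟩ := exists_generic_point hd ρ hρ ε k
  rw [linForm_dvd_iff_of_generic hρ h hk] at hdvd
  -- Substituting the root of the first form for the `k`-th variable in the second leaves these
  -- coefficients on the remaining, independent variables.
  have hsum : ∑ j ∈ Finset.univ.erase k,
      (AddMonoidAlgebra.single (Pi.single j (ε j : ℤ)) (ρ' j - ρ' k / ρ k * ρ j) : LaurentPoly d) =
      0 := by
    apply IsFractionRing.injective (LaurentPoly d) (FractionRing (LaurentPoly d))
    have e : (linForm ρ' ε) = ρ' k • .single (Pi.single k (ε k : ℤ)) 1 +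
        ∑ j ∈ Finset.univ.erase k, .single (Pi.single j (ε j : ℤ)) (ρ' j) := by
      rw [linForm, ← Finset.add_sum_erase _ _ (Finset.mem_univ k)]
      simp
    have e2 : π (∑ j ∈ Finset.univ.erase k, .single (Pi.single j (ε j : ℤ)) (ρ' j)) =
        algebraMap _ _ (∑ j ∈ Finset.univ.erase k,
          (.single (Pi.single j (ε j : ℤ)) (ρ' j) : LaurentPoly d)) := by
      rw [map_sum, map_sum]
      exact Finset.sum_congr rfl fun j hj => h _ _ (by simp [(Finset.ne_of_mem_erase hj).symm])
    rw [e, map_add, map_smul, hk, e2, ← algebraMap.coe_smul, ← map_add] at hdvd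
    rw [map_zero, ← hdvd]
    congr 1
    rw [linFormRoot, Finset.smul_sum, ← Finset.sum_add_distrib]
    refine Finset.sum_congr rfl fun j _ => ?_
    rw [AddMonoidAlgebra.smul_single, ← AddMonoidAlgebra.single_add]
    congr 1
    rw [smul_eq_mul]
    ring
  refine ⟨ρ' k / ρ k, fun j => ?_⟩
  by_cases hj : j = k
  · rw [hj, div_mul_cancel₀ _ (hρ k)]
  · have := congrArg (fun p => p.coeff (Pi.single j (ε j : ℤ))) hsum
    rw [coeff_sum_piSingle _ ε (fun j => ρ' j - ρ' k / ρ k * ρ j) (by simpa using hj)] at this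
    exact sub_eq_zero.1 this

/-! ### Characters and the discrete Fourier transform. -/

/-- The character `m ↦ ∏ j, exp (2 π i l_j m_j / q_j)` of `ℤ ^ d`. -/
def latticeChar (q : Fin d → ℕ) (l : FundCell q) (m : Fin d → ℤ) : ℂ :=
  ∏ j, Complex.exp (2 * Real.pi * Complex.I / q j) ^ ((l j : ℕ) * m j : ℤ)

theorem latticeChar_ne_zero (q : Fin d → ℕ) (l : FundCell q) (m : Fin d → ℤ) :
    latticeChar q l m ≠ 0 :=
  Finset.prod_ne_zero_iff.2 fun _ _ => zpow_ne_zero _ (Complex.exp_ne_zero _)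

theorem latticeChar_add (q : Fin d → ℕ) (l : FundCell q) (m m' : Fin d → ℤ) :
    latticeChar q l (m + m') = latticeChar q l m * latticeChar q l m' := by
  rw [latticeChar, latticeChar, latticeChar, ← Finset.prod_mul_distrib]
  refine Finset.prod_congr rfl fun j _ => ?_
  rw [← zpow_add₀ (Complex.exp_ne_zero _), Pi.add_apply, mul_add]

theorem latticeChar_piSingle (q : Fin d → ℕ) (l : FundCell q) (j : Fin d) (s : ℤ) :
    latticeChar q l (Pi.single j s) =
      Complex.exp (2 * Real.pi * Complex.I / q j) ^ ((l j : ℕ) * s : ℤ) := by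
  rw [latticeChar, Finset.prod_eq_single j]
  · simp
  · intro i _ hij
    simp [hij]
  · simp

theorem latticeChar_congr {q : Fin d → ℕ} (hq : ∀ j, 0 < q j) (l : FundCell q) {m m' : Fin d → ℤ}
    (h : ∀ j, (q j : ℤ) ∣ m j - m' j) : latticeChar q l m = latticeChar q l m' := by
  refine Finset.prod_congr rfl fun j _ => ?_
  obtain ⟨t, ht⟩ := h j
  have e : ((l j : ℕ) * m j : ℤ) = (l j : ℕ) * m' j + q j * ((l j : ℕ) * t) := by
    linear_combination ((l j : ℕ) : ℤ) * ht
  rw [e, zpow_add₀ (Complex.exp_ne_zero _), zpow_mul _ (q j : ℤ), zpow_natCast,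
    (Complex.isPrimitiveRoot_exp (q j) (hq j).ne').pow_eq_one, one_zpow, mul_one]

/-- The point of the fundamental domain congruent to `m`. -/
def cellReduce {q : Fin d → ℕ} (hq : ∀ j, 0 < q j) (m : Fin d → ℤ) : FundCell q := fun j =>
  ⟨(m j % q j).toNat, by
    have h1 := Int.emod_lt_of_pos (m j) (Int.natCast_pos.2 (hq j))
    have h2 := Int.emod_nonneg (m j) (Int.natCast_pos.2 (hq j)).ne'
    lia⟩

theorem dvd_sub_cellPoint_iff {q : Fin d → ℕ} (hq : ∀ j, 0 < q j) (m : Fin d → ℤ)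
    (n : FundCell q) : (∀ j, (q j : ℤ) ∣ m j - cellPoint n j) ↔ n = cellReduce hq m := by
  rw [funext_iff]
  refine forall_congr' fun j => ?_
  have h1 := Int.emod_lt_of_pos (m j) (Int.natCast_pos.2 (hq j))
  have h2 := Int.emod_nonneg (m j) (Int.natCast_pos.2 (hq j)).ne'
  have h3 : ((n j : ℕ) : ℤ) % q j = (n j : ℕ) :=
    Int.emod_eq_of_lt (by lia) (by exact_mod_cast (n j).2)
  rw [← Int.modEq_iff_dvd, Int.ModEq, cellPoint, h3, Fin.ext_iff, cellReduce]
  lia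

theorem cellReduce_spec {q : Fin d → ℕ} (hq : ∀ j, 0 < q j) (m : Fin d → ℤ) (j : Fin d) :
    (q j : ℤ) ∣ m j - cellPoint (cellReduce hq m) j :=
  (dvd_sub_cellPoint_iff hq m _).2 rfl j

theorem cellReduce_cellPoint {q : Fin d → ℕ} (hq : ∀ j, 0 < q j) (n : FundCell q) :
    cellReduce hq (cellPoint n) = n :=
  ((dvd_sub_cellPoint_iff hq _ n).1 fun j => by simp).symm

theorem sum_pow_exp_zpow {q : ℕ} (hq : 0 < q) (m : ℤ) :
    ∑ i : Fin q, Complex.exp (2 * Real.pi * Complex.I / q) ^ ((i : ℕ) * m : ℤ) =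
      if (q : ℤ) ∣ m then (q : ℂ) else 0 := by
  have hp := Complex.isPrimitiveRoot_exp q hq.ne'
  set ζ := Complex.exp (2 * Real.pi * Complex.I / q)
  have e : ∀ i : Fin q, ζ ^ ((i : ℕ) * m : ℤ) = (ζ ^ m) ^ (i : ℕ) := fun i => by
    rw [mul_comm, zpow_mul, zpow_natCast]
  simp only [e]
  rw [Fin.sum_univ_eq_sum_range fun i => (ζ ^ m) ^ i]
  split_ifs with h
  · rw [(hp.zpow_eq_one_iff_dvd m).2 h]
    simp
  · have h1 : ζ ^ m ≠ 1 := fun h1 => h ((hp.zpow_eq_one_iff_dvd m).1 h1)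
    have h2 := geom_sum_mul (ζ ^ m) q
    rw [← zpow_natCast, ← zpow_mul, mul_comm m, zpow_mul, zpow_natCast, hp.pow_eq_one, one_zpow,
      sub_self] at h2
    exact (mul_eq_zero.1 h2).resolve_right (sub_ne_zero.2 h1)

theorem sum_latticeChar {q : Fin d → ℕ} (hq : ∀ j, 0 < q j) (m : Fin d → ℤ) :
    ∑ l : FundCell q, latticeChar q l m =
      if ∀ j, (q j : ℤ) ∣ m j then ∏ j, (q j : ℂ) else 0 := by
  simp only [latticeChar]
  rw [← Fintype.prod_sum
    fun j (i : Fin (q j)) => Complex.exp (2 * Real.pi * Complex.I / q j) ^ ((i : ℕ) * m j : ℤ)]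
  simp only [sum_pow_exp_zpow (hq _)]
  split_ifs with h
  · exact Finset.prod_congr rfl fun j _ => if_pos (h j)
  · push Not at h
    obtain ⟨j, hj⟩ := h
    exact Finset.prod_eq_zero (Finset.mem_univ j) (if_neg hj)

/-- The matrix of the discrete Fourier transform. -/
def fourierMatrix (q : Fin d → ℕ) : Matrix (FundCell q) (FundCell q) ℂ :=
  Matrix.of fun n l => latticeChar q l (cellPoint n)

/-- Orthogonality of characters exhibits an inverse up to the nonzero scalar `∏ j, q j`. -/
theorem det_fourierMatrix_ne_zero {q : Fin d → ℕ} (hq : ∀ j, 0 < q j) :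
    (fourierMatrix q).det ≠ 0 := by
  have h : fourierMatrix q * Matrix.of (fun l n => latticeChar q l (-cellPoint n)) =
      (∏ j, (q j : ℂ)) • (1 : Matrix (FundCell q) (FundCell q) ℂ) := by
    ext n n'
    simp only [Matrix.mul_apply, fourierMatrix, Matrix.of_apply, ← latticeChar_add]
    rw [sum_latticeChar hq, Matrix.smul_apply, Matrix.one_apply]
    have := dvd_sub_cellPoint_iff hq (cellPoint n) n'
    rw [cellReduce_cellPoint] at this
    simp only [Pi.add_apply, Pi.neg_apply, ← sub_eq_add_neg, this, eq_comm (a := n'), smul_eq_mul,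
      mul_ite, mul_one, mul_zero]
  intro h0
  have := congrArg Matrix.det h
  rw [Matrix.det_mul, h0, zero_mul, Matrix.det_smul, Matrix.det_one, mul_one] at this
  exact pow_ne_zero _ (Finset.prod_ne_zero_iff.2 fun j _ => Nat.cast_ne_zero.2 (hq j).ne') this.symm

/-! ### The Floquet determinant after the substitution. -/

/-- The Floquet matrix of `-Δ + V - lam` in the variables `w` with `w_j ^ (q_j) = z_j`, conjugated
by the diagonal matrix with entries `w ^ n`. -/
def reducedMatrix (q : Fin d → ℕ) (V : (Fin d → ℤ) → ℂ) (lam : ℂ) :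
    Matrix (FundCell q) (FundCell q) (LaurentPoly d) :=
  Matrix.of fun n n' => -∑ j,
    ((if ∀ i, (q i : ℤ) ∣ (cellPoint n + Pi.single j 1 : Fin d → ℤ) i - cellPoint n' i then
        zpowMon (Pi.single j 1) else 0) +
      if ∀ i, (q i : ℤ) ∣ (cellPoint n - Pi.single j 1 : Fin d → ℤ) i - cellPoint n' i then
        zpowMon (-Pi.single j 1) else 0) +
    if n = n' then AddMonoidAlgebra.single 0 (V (cellPoint n) - lam) else 0

/-- Multiplication of exponents by the periods. -/
def scaleHom (q : Fin d → ℕ) : (Fin d → ℤ) →+ (Fin d → ℤ) where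
  toFun a j := q j * a j
  map_zero' := by ext; simp
  map_add' a b := by ext; simp [mul_add]

/-- The substitution `z_j = w_j ^ (q_j)`. -/
def rootSubst (q : Fin d → ℕ) : LaurentPoly d →+* LaurentPoly d :=
  AddMonoidAlgebra.mapDomainRingHom ℂ (scaleHom q)

theorem rootSubst_single (q : Fin d → ℕ) (a : Fin d → ℤ) (r : ℂ) :
    rootSubst q (.single a r) = .single (scaleHom q a) r := by
  simp [rootSubst]

theorem floquetExtension_piSingle (q : Fin d → ℕ) (n' : FundCell q) (m : Fin d → ℤ) :
    floquetExtension q (Pi.single n' 1) m =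
      if ∀ j, (q j : ℤ) ∣ m j - cellPoint n' j then
        zpowMon (fun j => (m j - cellPoint n' j) / (q j : ℤ)) else 0 := by
  rw [floquetExtension, Finset.sum_eq_single n']
  · simp
  · intro n _ hn
    simp [hn]
  · simp

/-- The Floquet multiplier becomes `w ^ (m - n')`, and the conjugating factor `w ^ n'` completes it
to `w ^ m`. Dividing by `w ^ n` for the row index then leaves only the hop `m - n`. -/
theorem rootSubst_floquetExtension_mul {q : Fin d → ℕ} (n' : FundCell q) (m : Fin d → ℤ) :
    rootSubst q (floquetExtension q (Pi.single n' 1) m) * zpowMon (cellPoint n') =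
      if ∀ j, (q j : ℤ) ∣ m j - cellPoint n' j then zpowMon m else 0 := by
  rw [floquetExtension_piSingle]
  split_ifs with h
  · rw [zpowMon, zpowMon, zpowMon, rootSubst_single, AddMonoidAlgebra.single_mul_single, one_mul]
    congr 1
    ext j
    simp [scaleHom, Int.mul_ediv_cancel' (h j)]
  · rw [map_zero, zero_mul]

theorem zpowMon_add (a b : Fin d → ℤ) :
    (zpowMon (a + b) : LaurentPoly d) = zpowMon a * zpowMon b := by
  rw [zpowMon, zpowMon, zpowMon, AddMonoidAlgebra.single_mul_single, one_mul]

theorem rootSubst_floquetDet {q : Fin d → ℕ} (hq : ∀ j, 0 < q j) (V : (Fin d → ℤ) → ℂ) (lam : ℂ) :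
    rootSubst q (floquetDet q V lam) = (reducedMatrix q V lam).det := by
  have key : (rootSubst q).mapMatrix
        (floquetMatrix q V - lam • (1 : Matrix (FundCell q) (FundCell q) (LaurentPoly d))) *
        Matrix.diagonal (fun n => zpowMon (cellPoint n)) =
      Matrix.diagonal (fun n => zpowMon (cellPoint n)) * reducedMatrix q V lam := by
    ext1 n n'
    have hC : ∀ (c : ℂ) (f : LaurentPoly d), rootSubst q (c • f) = c • rootSubst q f := fun c f => by
      have h : ∀ (g : LaurentPoly d), c • g = AddMonoidAlgebra.single 0 c * g := fun g => by
        rw [Algebra.smul_def]; rfl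
      rw [h, h, map_mul, rootSubst_single, map_zero]
    have hd := dvd_sub_cellPoint_iff hq (cellPoint n) n'
    rw [cellReduce_cellPoint] at hd
    rw [Matrix.mul_diagonal, Matrix.diagonal_mul, RingHom.mapMatrix_apply, Matrix.map_apply,
      Matrix.sub_apply, Matrix.smul_apply, floquetMatrix, Matrix.of_apply, schrodingerOp,
      discreteLaplacian, map_sub, map_add, map_neg, map_sum, sub_mul, add_mul, neg_mul,
      Finset.sum_mul, hC, hC, smul_mul_assoc, rootSubst_floquetExtension_mul, reducedMatrix,
      Matrix.of_apply, mul_add, mul_neg, Finset.mul_sum, add_sub_assoc]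
    congr 1
    · congr 1
      refine Finset.sum_congr rfl fun j _ => ?_
      rw [map_add, add_mul, rootSubst_floquetExtension_mul, rootSubst_floquetExtension_mul, mul_add,
        mul_ite, mul_ite, ← zpowMon_add, ← zpowMon_add, mul_zero, sub_eq_add_neg]
    · simp only [hd, Matrix.one_apply, eq_comm (a := n')]
      by_cases h : n = n'
      · subst h
        simp [zpowMon, mul_sub]
      · simp [h]
  have hdet := congrArg Matrix.det key
  rw [Matrix.det_mul, Matrix.det_mul, mul_comm] at hdet
  rw [floquetDet, RingHom.map_det]
  refine mul_left_cancel₀ ?_ hdet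
  rw [Matrix.det_diagonal]
  exact Finset.prod_ne_zero_iff.2 fun n _ => AddMonoidAlgebra.single_ne_zero.2 one_ne_zero

/-! ### The leading part of the determinant for a sign pattern. -/

/-- The weight vector of a sign pattern. -/
def signWeight (ε : Fin d → ℤˣ) : Fin d → ℤ := fun j => (ε j : ℤ)

/-- The terms of highest weight of `reducedMatrix`. -/
def leadingMatrix (q : Fin d → ℕ) (ε : Fin d → ℤˣ) :
    Matrix (FundCell q) (FundCell q) (LaurentPoly d) :=
  Matrix.of fun n n' => ∑ j,
    if ∀ i, (q i : ℤ) ∣ (cellPoint n + Pi.single j (ε j : ℤ) : Fin d → ℤ) i - cellPoint n' i then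
      .single (Pi.single j (ε j : ℤ)) (-1) else 0

theorem signWeight_dotProduct_piSingle (ε : Fin d → ℤˣ) (j : Fin d) (s : ℤ) :
    signWeight ε ⬝ᵥ Pi.single j s = ε j * s := by
  simp [signWeight]

theorem weightLE_reducedMatrix (q : Fin d → ℕ) (V : (Fin d → ℤ) → ℂ) (lam : ℂ) (ε : Fin d → ℤˣ)
    (n n' : FundCell q) : WeightLE (signWeight ε) 1 (reducedMatrix q V lam n n') := by
  refine .add (.neg (.sum fun j _ => .add ?_ ?_)) ?_
  · split_ifs
    · refine .single ?_ 1
      rw [signWeight_dotProduct_piSingle]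
      rcases Int.units_eq_one_or (ε j) with e | e <;> simp [e]
    · exact .zero _ _
  · split_ifs
    · refine .single ?_ 1
      rw [dotProduct_neg, signWeight_dotProduct_piSingle]
      rcases Int.units_eq_one_or (ε j) with e | e <;> simp [e]
    · exact .zero _ _
  · split_ifs
    · exact .single (by simp) _
    · exact .zero _ _

theorem weightPart_reducedMatrix (q : Fin d → ℕ) (V : (Fin d → ℤ) → ℂ) (lam : ℂ)
    (ε : Fin d → ℤˣ) :
    (reducedMatrix q V lam).map (weightPart (signWeight ε) 1) = leadingMatrix q ε := by
  ext1 n n'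
  rw [Matrix.map_apply, reducedMatrix, leadingMatrix, Matrix.of_apply, Matrix.of_apply, map_add,
    map_neg, map_sum, apply_ite (weightPart (signWeight ε) 1), weightPart_single, map_zero,
    dotProduct_zero, if_neg zero_ne_one, ite_self, add_zero, ← Finset.sum_neg_distrib]
  refine Finset.sum_congr rfl fun j _ => ?_
  rw [map_add, apply_ite (weightPart (signWeight ε) 1), apply_ite (weightPart (signWeight ε) 1),
    map_zero, zpowMon, zpowMon, weightPart_single, weightPart_single, dotProduct_neg,
    signWeight_dotProduct_piSingle]
  rcases Int.units_eq_one_or (ε j) with e | e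
  · simp only [e, Units.val_one, mul_one, ↓reduceIte, AddMonoidAlgebra.single_neg]
    norm_num
    split_ifs <;> simp
  · simp only [e, Units.val_neg, Units.val_one, mul_one, AddMonoidAlgebra.single_neg, Pi.single_neg,
      ← sub_eq_add_neg]
    norm_num
    split_ifs <;> simp

/-- The coefficients of the linear factors of the leading part of the determinant. -/
def leadingCoeffs (q : Fin d → ℕ) (ε : Fin d → ℤˣ) (l : FundCell q) (j : Fin d) : ℂ :=
  -latticeChar q l (Pi.single j (ε j : ℤ))

/-- The leading matrix is a combination of translations modulo the periods, so the characters are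
common eigenvectors and the linear forms are the eigenvalues. -/
theorem det_leadingMatrix {q : Fin d → ℕ} (hq : ∀ j, 0 < q j) (ε : Fin d → ℤˣ) :
    (leadingMatrix q ε).det = ∏ l, linForm (leadingCoeffs q ε l) ε := by
  have key : leadingMatrix q ε * (algebraMap ℂ (LaurentPoly d)).mapMatrix (fourierMatrix q) =
      (algebraMap ℂ (LaurentPoly d)).mapMatrix (fourierMatrix q) *
        Matrix.diagonal fun l => linForm (leadingCoeffs q ε l) ε := by
    ext1 n l
    rw [Matrix.mul_diagonal, Matrix.mul_apply, RingHom.mapMatrix_apply]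
    simp only [Matrix.map_apply, leadingMatrix, Matrix.of_apply, fourierMatrix, Finset.sum_mul,
      ite_mul, zero_mul, dvd_sub_cellPoint_iff hq]
    rw [Finset.sum_comm, linForm, Finset.mul_sum]
    refine Finset.sum_congr rfl fun j _ => ?_
    rw [Finset.sum_ite_eq' Finset.univ, if_pos (Finset.mem_univ _),
      ← latticeChar_congr hq l (cellReduce_spec hq _), latticeChar_add, leadingCoeffs]
    change _ * AddMonoidAlgebra.single 0 _ = AddMonoidAlgebra.single 0 _ * _
    rw [AddMonoidAlgebra.single_mul_single, AddMonoidAlgebra.single_mul_single, add_comm]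
    congr 1
    simp only [Algebra.algebraMap_self, RingHom.id_apply]
    ring
  have hdet := congrArg Matrix.det key
  rw [Matrix.det_mul, Matrix.det_mul, mul_comm, Matrix.det_diagonal] at hdet
  refine mul_left_cancel₀ ?_ hdet
  rw [← RingHom.map_det]
  exact (map_ne_zero_iff _ (FaithfulSMul.algebraMap_injective ℂ (LaurentPoly d))).2
    (det_fourierMatrix_ne_zero hq)

/-! ### Root-of-unity symmetry and indivisibility of the leading part. -/

/-- The action `z_j ↦ s_j z_j` of the torus on Laurent polynomials. -/
def torusAct (s : Fin d → ℂˣ) : LaurentPoly d →ₐ[ℂ] LaurentPoly d :=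
  AddMonoidAlgebra.lift ℂ (LaurentPoly d) (Fin d → ℤ)
    { toFun := fun a => .single a.toAdd (∏ j, s j ^ (a.toAdd j) : ℂˣ)
      map_one' := by simp [AddMonoidAlgebra.one_def]
      map_mul' := fun a b => by
        rw [AddMonoidAlgebra.single_mul_single, ← Units.val_mul, ← Finset.prod_mul_distrib]
        simp only [toAdd_mul, Pi.add_apply, zpow_add] }

theorem torusAct_single (s : Fin d → ℂˣ) (a : Fin d → ℤ) (r : ℂ) :
    torusAct s (.single a r) = .single a (r * (∏ j, s j ^ a j : ℂˣ)) := by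
  simp [torusAct]

theorem coeff_torusAct (s : Fin d → ℂˣ) (f : LaurentPoly d) (a : Fin d → ℤ) :
    (torusAct s f).coeff a = f.coeff a * (∏ j, s j ^ a j : ℂˣ) := by
  induction f using AddMonoidAlgebra.induction_linear with
  | zero => simp
  | add f g hf hg => rw [map_add, AddMonoidAlgebra.coeff_add, AddMonoidAlgebra.coeff_add,
      Finsupp.add_apply, Finsupp.add_apply, hf, hg, add_mul]
  | single b r =>
    rw [torusAct_single]
    by_cases h : b = a
    · subst h; simp
    · simp [h]

theorem torusAct_linForm (s : Fin d → ℂˣ) (ρ : Fin d → ℂ) (ε : Fin d → ℤˣ) :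
    torusAct s (linForm ρ ε) = linForm (fun j => ρ j * (s j ^ (ε j : ℤ) : ℂˣ)) ε := by
  rw [linForm, map_sum, linForm]
  refine Finset.sum_congr rfl fun j _ => ?_
  rw [torusAct_single]
  congr 3
  rw [Finset.prod_eq_single j]
  · simp
  · intro i _ hij
    simp [hij]
  · simp

/-- All exponents of `f` lie in the lattice `q_1 ℤ ⊕ ⋯ ⊕ q_d ℤ`. -/
def LatticeSupported (q : Fin d → ℕ) (f : LaurentPoly d) : Prop :=
  ∀ a, f.coeff a ≠ 0 → ∀ j, (q j : ℤ) ∣ a j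

theorem latticeSupported_rootSubst (q : Fin d → ℕ) (f : LaurentPoly d) :
    LatticeSupported q (rootSubst q f) := by
  induction f using AddMonoidAlgebra.induction_linear with
  | zero => intro a ha; simp at ha
  | add f g hf hg =>
    intro a ha
    by_cases h : (rootSubst q f).coeff a = 0
    · exact hg a fun h' => ha (by simp [h, h'])
    · exact hf a h
  | single b r =>
    intro a ha j
    rw [rootSubst_single, AddMonoidAlgebra.coeff_single, Finsupp.single_apply] at ha
    split_ifs at ha with h
    · exact ⟨b j, by rw [← h]; rfl⟩
    · exact absurd rfl ha

theorem LatticeSupported.weightPart {q : Fin d → ℕ} {f : LaurentPoly d} (hf : LatticeSupported q f)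
    (c : Fin d → ℤ) (n : ℤ) : LatticeSupported q (weightPart c n f) := fun a ha => by
  rw [coeff_weightPart] at ha
  split_ifs at ha with h
  · exact hf a ha
  · exact absurd rfl ha

theorem LatticeSupported.torusAct_eq {q : Fin d → ℕ} {f : LaurentPoly d} (hf : LatticeSupported q f)
    {s : Fin d → ℂˣ} (hs : ∀ j, s j ^ q j = 1) : torusAct s f = f := by
  ext a
  rw [coeff_torusAct]
  by_cases h : f.coeff a = 0
  · rw [h, zero_mul]
  · rw [Finset.prod_eq_one, Units.val_one, mul_one]
    intro j _
    obtain ⟨t, ht⟩ := hf a h j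
    rw [ht, zpow_mul, zpow_natCast, hs, one_zpow]

theorem leadingCoeffs_ne_zero (q : Fin d → ℕ) (ε : Fin d → ℤˣ) (l : FundCell q) (j : Fin d) :
    leadingCoeffs q ε l j ≠ 0 :=
  neg_ne_zero.2 (latticeChar_ne_zero _ _ _)

theorem leadingCoeffs_pow {q : Fin d → ℕ} (hq : ∀ j, 0 < q j) (ε : Fin d → ℤˣ) (l : FundCell q)
    (j : Fin d) : leadingCoeffs q ε l j ^ q j = (-1) ^ q j := by
  rw [leadingCoeffs, latticeChar_piSingle, neg_pow, ← zpow_natCast (Complex.exp _ ^ _), ← zpow_mul,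
    mul_comm _ ((q j : ℕ) : ℤ), zpow_mul, zpow_natCast (Complex.exp _),
    (Complex.isPrimitiveRoot_exp (q j) (hq j).ne').pow_eq_one, one_zpow, mul_one]

/-- Divisibility makes the coefficient vectors proportional by some `c`. Their `q j`-th powers
agree, so the order of `c` divides every period, hence `c = 1`; primitivity of the roots of unity
then recovers the index. -/
theorem eq_of_linForm_leadingCoeffs_dvd (hd : 2 ≤ d) {q : Fin d → ℕ} (hq : ∀ j, 0 < q j)
    (hgcd : Finset.univ.gcd q = 1) (ε : Fin d → ℤˣ) {l l' : FundCell q}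
    (h : linForm (leadingCoeffs q ε l) ε ∣ linForm (leadingCoeffs q ε l') ε) : l = l' := by
  obtain ⟨c, hc⟩ := proportional_of_linForm_dvd hd (leadingCoeffs_ne_zero q ε l) h
  have hcq : ∀ j, c ^ q j = 1 := fun j => by
    have := congrArg (· ^ q j) (hc j)
    simp only [mul_pow, leadingCoeffs_pow hq] at this
    exact (mul_eq_right₀ (pow_ne_zero _ (by norm_num))).1 this.symm
  have hc1 : c = 1 := by
    rw [← orderOf_eq_one_iff, ← Nat.dvd_one, ← hgcd]
    exact Finset.dvd_gcd fun j _ => orderOf_dvd_of_pow_eq_one (hcq j)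
  ext1 j
  have hj := hc j
  rw [hc1, one_mul, leadingCoeffs, leadingCoeffs, latticeChar_piSingle, latticeChar_piSingle,
    neg_inj, zpow_mul, zpow_mul, zpow_natCast, zpow_natCast] at hj
  have hp : Complex.exp (2 * Real.pi * Complex.I / q j) ^ (l' j : ℕ) =
      Complex.exp (2 * Real.pi * Complex.I / q j) ^ (l j : ℕ) := by
    rcases Int.units_eq_one_or (ε j) with e | e <;> rw [e] at hj
    · simpa using hj
    · simpa only [Units.val_neg, Units.val_one, zpow_neg, zpow_one, inv_inj] using hj
  exact Fin.ext ((Complex.isPrimitiveRoot_exp (q j) (hq j).ne').pow_inj (l j).2 (l' j).2 hp.symm)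

theorem linForm_leadingCoeffs_dvd {q : Fin d → ℕ} (hq : ∀ j, 0 < q j) {ε : Fin d → ℤˣ}
    {F : LaurentPoly d} (hF : LatticeSupported q F) {l : FundCell q}
    (h : linForm (leadingCoeffs q ε l) ε ∣ F) (l' : FundCell q) :
    linForm (leadingCoeffs q ε l') ε ∣ F := by
  let ζ : Fin d → ℂˣ := fun j => Units.mk0 (Complex.exp (2 * Real.pi * Complex.I / q j))
    (Complex.exp_ne_zero _)
  have hζ : ∀ j, ζ j ^ q j = 1 := fun j => by
    ext1
    simpa [ζ] using (Complex.isPrimitiveRoot_exp (q j) (hq j).ne').pow_eq_one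
  -- This rotation carries the form of index `l` to that of index `l'` and fixes `F`.
  let s : Fin d → ℂˣ := fun j => ζ j ^ ((l' j : ℕ) - (l j : ℕ) : ℤ)
  have hs : ∀ j, s j ^ q j = 1 := fun j => by
    rw [← zpow_natCast, ← zpow_mul, mul_comm, zpow_mul, zpow_natCast, hζ, one_zpow]
  have := map_dvd (torusAct s) h
  rw [hF.torusAct_eq hs, torusAct_linForm] at this
  convert this using 2
  ext j
  rw [leadingCoeffs, leadingCoeffs, latticeChar_piSingle, latticeChar_piSingle, neg_mul, neg_inj,
    ← zpow_mul, Units.val_zpow_eq_zpow_val, Units.val_mk0, ← zpow_add₀ (Complex.exp_ne_zero _)]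
  congr 1
  ring

theorem isUnit_of_linForm_dvd (hd : 2 ≤ d) {q : Fin d → ℕ} (hq : ∀ j, 0 < q j)
    (hgcd : Finset.univ.gcd q = 1) {ε : Fin d → ℤˣ} {F G : LaurentPoly d}
    (hF : LatticeSupported q F) (hFG : F * G = ∏ l, linForm (leadingCoeffs q ε l) ε)
    {l : FundCell q} (h : linForm (leadingCoeffs q ε l) ε ∣ F) : IsUnit G := by
  have hp := fun l : FundCell q => prime_linForm hd (leadingCoeffs_ne_zero q ε l) ε
  obtain ⟨H, hH⟩ : ∏ l, linForm (leadingCoeffs q ε l) ε ∣ F :=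
    Finset.prod_dvd_of_prime_of_not_dvd (fun l _ => hp l)
      (fun l' _ => linForm_leadingCoeffs_dvd hq hF h l')
      fun _ _ _ _ => eq_of_linForm_leadingCoeffs_dvd hd hq hgcd ε
  have h0 : ∏ l, linForm (leadingCoeffs q ε l) ε ≠ 0 :=
    Finset.prod_ne_zero_iff.2 fun l _ => (hp l).ne_zero
  rw [hH, mul_assoc] at hFG
  exact IsUnit.of_mul_eq_one_right H ((mul_eq_left₀ h0).1 hFG)

theorem isUnit_or_isUnit_of_mul_eq (hd : 2 ≤ d) {q : Fin d → ℕ} (hq : ∀ j, 0 < q j)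
    (hgcd : Finset.univ.gcd q = 1) {ε : Fin d → ℤˣ} {F G : LaurentPoly d}
    (hF : LatticeSupported q F) (hG : LatticeSupported q G)
    (hFG : F * G = ∏ l, linForm (leadingCoeffs q ε l) ε) : IsUnit F ∨ IsUnit G := by
  let l : FundCell q := fun j => ⟨0, hq j⟩
  have hl : linForm (leadingCoeffs q ε l) ε ∣ F * G := hFG ▸ Finset.dvd_prod_of_mem _ (Finset.mem_univ l)
  rcases (prime_linForm hd (leadingCoeffs_ne_zero q ε l) ε).dvd_or_dvd hl with h | h
  · exact .inr (isUnit_of_linForm_dvd hd hq hgcd hF hFG h)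
  · exact .inl (isUnit_of_linForm_dvd hd hq hgcd hG (mul_comm F G ▸ hFG) h)

/-! ### The Newton polytope and its facets. -/

/-- The points `± Q e_k` are vertices of the Newton polytope. In the leading product for the
constant pattern `u`, a second weight `c` retains only the `k`-th term of each linear form, so the
coefficient is a product of nonzero numbers. -/
theorem coeff_det_reducedMatrix_ne_zero {q : Fin d → ℕ} (hq : ∀ j, 0 < q j)
    (V : (Fin d → ℤ) → ℂ) (lam : ℂ) (k : Fin d) (u : ℤˣ) :
    (reducedMatrix q V lam).det.coeff (Pi.single k (Fintype.card (FundCell q) * u : ℤ)) ≠ 0 := by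
  let ε : Fin d → ℤˣ := fun _ => u
  let c : Fin d → ℤ := Pi.single k (u : ℤ)
  have hu : (u : ℤ) * u = 1 := by rw [← Units.val_mul, Int.units_mul_self, Units.val_one]
  have hc : ∀ j, c ⬝ᵥ Pi.single j (ε j : ℤ) = if j = k then 1 else 0 := fun j => by
    by_cases h : j = k
    · subst h; simp [c, ε, hu]
    · simp [c, h]
  have hL : ∀ l, WeightLE c 1 (linForm (leadingCoeffs q ε l) ε) := fun l =>
    .sum fun j _ => .single (by rw [hc]; split_ifs <;> simp) _
  have hL1 : ∀ l, weightPart c 1 (linForm (leadingCoeffs q ε l) ε) =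
      .single (Pi.single k (u : ℤ)) (leadingCoeffs q ε l k) := fun l => by
    rw [linForm, map_sum, Finset.sum_eq_single k]
    · rw [weightPart_single, hc, if_pos rfl, if_pos rfl]
    · intro j _ hj
      rw [weightPart_single, hc, if_neg hj, if_neg (by norm_num)]
    · simp
  have hprod : ∀ s : Finset (FundCell q), ∏ l ∈ s, (AddMonoidAlgebra.single (Pi.single k (u : ℤ))
      (leadingCoeffs q ε l k) : LaurentPoly d) =
      .single (Pi.single k (s.card * u : ℤ)) (∏ l ∈ s, leadingCoeffs q ε l k) := fun s => by
    classical
    induction s using Finset.induction_on with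
    | empty => simp [AddMonoidAlgebra.one_def]
    | insert l s hl ih =>
      rw [Finset.prod_insert hl, Finset.prod_insert hl, ih, AddMonoidAlgebra.single_mul_single,
        ← Pi.single_add, Finset.card_insert_of_notMem hl]
      congr 2
      push_cast
      ring
  have h1 := (weightLE_and_weightPart_prod Finset.univ fun l _ => hL l).2
  simp only [hL1] at h1
  rw [hprod, ← det_leadingMatrix hq, ← weightPart_reducedMatrix q V lam,
    ← (weightLE_and_weightPart_det (weightLE_reducedMatrix q V lam ε)).2, Finset.card_univ] at h1
  intro h0
  have h2 := congrArg (fun p => p.coeff (Pi.single k (Fintype.card (FundCell q) * u : ℤ))) h1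
  simp only [coeff_weightPart, h0, ite_self, AddMonoidAlgebra.coeff_single,
    Finsupp.single_eq_same] at h2
  exact Finset.prod_ne_zero_iff.2 (fun l _ => leadingCoeffs_ne_zero q ε l k) h2.symm

/-- `a` is the only exponent of `f` at which the weight `c` attains its maximum. -/
def IsUniqueMax (c : Fin d → ℤ) (f : LaurentPoly d) (a : Fin d → ℤ) : Prop :=
  f.coeff a ≠ 0 ∧ ∀ b, f.coeff b ≠ 0 → b ≠ a → c ⬝ᵥ b < c ⬝ᵥ a

theorem IsUniqueMax.eq_of_weightLE {c : Fin d → ℤ} {f : LaurentPoly d} {a b : Fin d → ℤ} {n : ℤ}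
    (h : IsUniqueMax c f a) (hn : WeightLE c n f) (hb : f.coeff b ≠ 0) (hbn : c ⬝ᵥ b = n) :
    b = a := by
  by_contra hba
  have h1 := h.2 b hb hba
  have h2 := hn a h.1
  lia

theorem IsLaurentMonomial.exists_isUniqueMax {c : Fin d → ℤ} {f : LaurentPoly d} {n : ℤ}
    (h : IsLaurentMonomial (weightPart c n f)) (hn : WeightLE c n f) : ∃ a, IsUniqueMax c f a := by
  obtain ⟨a, C, hC, e⟩ := h
  have hcoeff : ∀ b, (if c ⬝ᵥ b = n then f.coeff b else 0) = if a = b then C else 0 := fun b => by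
    rw [← coeff_weightPart, e, AddMonoidAlgebra.coeff_single, Finsupp.single_apply]
  have ha := hcoeff a
  rw [if_pos (rfl : a = a)] at ha
  split_ifs at ha with h1
  · refine ⟨a, ha ▸ hC, fun b hb hba => ?_⟩
    rw [h1]
    refine lt_of_le_of_ne (hn b hb) fun h2 => ?_
    have := hcoeff b
    rw [if_pos h2, if_neg (Ne.symm hba)] at this
    exact hb this
  · exact absurd ha.symm hC

theorem isLaurentMonomial_of_forall {f : LaurentPoly d} {a : Fin d → ℤ} (ha : f.coeff a ≠ 0)
    (h : ∀ b, f.coeff b ≠ 0 → b = a) : IsLaurentMonomial f := by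
  refine ⟨a, f.coeff a, ha, ?_⟩
  ext b
  by_cases hb : b = a
  · subst hb; simp
  · rw [AddMonoidAlgebra.coeff_single, Finsupp.single_apply, if_neg (Ne.symm hb)]
    by_contra h0
    exact hb (h b h0)

theorem coeff_rootSubst_scaleHom {q : Fin d → ℕ} (hq : ∀ j, 0 < q j) (f : LaurentPoly d)
    (a : Fin d → ℤ) : (rootSubst q f).coeff (scaleHom q a) = f.coeff a := by
  refine Finsupp.mapDomain_apply (f := scaleHom q) (fun a b hab => ?_) f.coeff a
  ext j
  exact mul_left_cancel₀ (Int.natCast_pos.2 (hq j)).ne' (congrFun hab j)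

theorem isLaurentMonomial_of_rootSubst {q : Fin d → ℕ} (hq : ∀ j, 0 < q j) {f : LaurentPoly d}
    (h : IsLaurentMonomial (rootSubst q f)) : IsLaurentMonomial f := by
  obtain ⟨a, C, hC, e⟩ := h
  have key : ∀ b, f.coeff b ≠ 0 → scaleHom q b = a := fun b hb => by
    rw [← coeff_rootSubst_scaleHom hq, e, AddMonoidAlgebra.coeff_single, Finsupp.single_apply] at hb
    split_ifs at hb with h
    · exact h.symm
    · exact absurd rfl hb
  have hf : f ≠ 0 := fun h0 => by
    rw [h0, map_zero, eq_comm, AddMonoidAlgebra.single_eq_zero] at e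
    exact hC e
  obtain ⟨b, hb⟩ : ∃ b, f.coeff b ≠ 0 := by
    by_contra! h0
    exact hf (by ext b; exact h0 b)
  refine isLaurentMonomial_of_forall hb fun b' hb' => ?_
  ext j
  exact mul_left_cancel₀ (Int.natCast_pos.2 (hq j)).ne' (congrFun ((key b' hb').trans (key b hb).symm) j)

/-- A combinatorial criterion: the faces of a cross-polytope are connected through ridges of
positive dimension, so a Minkowski summand that is a vertex on one facet is a point. -/
theorem isLaurentMonomial_of_isUniqueMax (hd : 3 ≤ d) {F G : LaurentPoly d} {Q : ℤ} (hQ : 0 < Q)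
    (hmax : ∀ ε : Fin d → ℤˣ, (∃ a, IsUniqueMax (signWeight ε) F a) ∨
      ∃ a, IsUniqueMax (signWeight ε) G a)
    (hle : ∀ ε : Fin d → ℤˣ, ∃ m n, WeightLE (signWeight ε) m F ∧ WeightLE (signWeight ε) n G ∧
      m + n = Q)
    (hvert : ∀ k (u : ℤˣ), ∃ a b, F.coeff a ≠ 0 ∧ G.coeff b ≠ 0 ∧ a + b = Pi.single k (Q * u : ℤ))
    {ε : Fin d → ℤˣ} {a : Fin d → ℤ} (ha : IsUniqueMax (signWeight ε) G a) :
    IsLaurentMonomial G := by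
  choose f g hf hg hfg using hvert
  -- The vertex `Q ε_k e_k` has the maximal weight `Q = m + n`, so both of its summands are maximal
  -- in their factors.
  have hface : ∀ (ε : Fin d → ℤˣ) k,
      (∀ b, IsUniqueMax (signWeight ε) F b → f k (ε k) = b) ∧
      ∀ b, IsUniqueMax (signWeight ε) G b → g k (ε k) = b := fun ε k => by
    obtain ⟨m, n, hm, hn, hmn⟩ := hle ε
    have h1 := congrArg (signWeight ε ⬝ᵥ ·) (hfg k (ε k))
    simp only [dotProduct_add, signWeight_dotProduct_piSingle] at h1
    have h2 := hm _ (hf k (ε k))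
    have h3 := hn _ (hg k (ε k))
    have hu : (ε k : ℤ) * (Q * ε k) = Q := by
      rcases Int.units_eq_one_or (ε k) with e | e <;> simp [e]
    exact ⟨fun b hb => hb.eq_of_weightLE hm (hf _ _) (by lia),
      fun b hb => hb.eq_of_weightLE hn (hg _ _) (by lia)⟩
  have hstep : ∀ (ε ε' : Fin d → ℤˣ) (k : Fin d), (∀ j, j ≠ k → ε j = ε' j) →
      IsUniqueMax (signWeight ε) G a → IsUniqueMax (signWeight ε') G a := by
    intro ε ε' k hk ha
    obtain ⟨i, j, hij, hik, hjk⟩ : ∃ i j : Fin d, i ≠ j ∧ i ≠ k ∧ j ≠ k := by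
      have h1 : 1 < (Finset.univ.erase k).card := by
        rw [Finset.card_erase_of_mem (Finset.mem_univ k), Finset.card_univ, Fintype.card_fin]
        lia
      obtain ⟨i, hi, j, hj, hij⟩ := Finset.one_lt_card.1 h1
      exact ⟨i, j, hij, Finset.ne_of_mem_erase hi, Finset.ne_of_mem_erase hj⟩
    -- A unique maximum `b` of `F` on the new facet would make `b + a` equal to two distinct
    -- vertices of the common ridge. So `G` has the unique maximum there, and a shared vertex
    -- identifies it with `a`.
    rcases hmax ε' with ⟨b, hb⟩ | ⟨b, hb⟩
    · have key : ∀ i, i ≠ k → b + a = Pi.single i (Q * ε i : ℤ) := fun i hi => by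
        rw [← (hface ε' i).1 b hb, ← (hface ε i).2 a ha, ← hk i hi, hfg]
      have := congrFun ((key i hik).symm.trans (key j hjk)) i
      rw [Pi.single_eq_same, Pi.single_eq_of_ne hij] at this
      exact absurd this (mul_ne_zero hQ.ne' (ε i).ne_zero)
    · rwa [← (hface ε i).2 a ha, hk i hik, (hface ε' i).2 b hb]
  have hall : ∀ ε' : Fin d → ℤˣ, IsUniqueMax (signWeight ε') G a := fun ε' => by
    -- Any facet is reached by changing one sign at a time.
    have h : ∀ s : Finset (Fin d), IsUniqueMax (signWeight (s.piecewise ε' ε)) G a := fun s => by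
      induction s using Finset.induction_on with
      | empty => simpa using ha
      | insert k s hk ih =>
        refine hstep _ _ k (fun j hj => ?_) ih
        rw [Finset.piecewise_insert, Function.update_of_ne hj]
    simpa using h Finset.univ
  refine isLaurentMonomial_of_forall ha.1 fun b hb => ?_
  by_contra hba
  -- Strict maximality at `a` for two opposite weights excludes any other exponent.
  have h1 := (hall ε).2 b hb hba
  have h2 := (hall (-ε)).2 b hb hba
  have e : signWeight (-ε) = -signWeight ε := by ext j; simp [signWeight]
  rw [e, neg_dotProduct, neg_dotProduct] at h2
  lia

end

/-! ### Assembly. -/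

theorem theorem2 (d : ℕ) (hd : 3 ≤ d) (q : Fin d → ℕ) (hq : ∀ j, 0 < q j)
    (hgcd : Finset.univ.gcd q = 1) (V : (Fin d → ℤ) → ℂ) (hV : IsLatticePeriodic q V) (lam : ℂ) :
    IsLaurentIrreducible (floquetDet q V lam) := by
  rintro ⟨f, g, hf, hg, hfg⟩
  set F := rootSubst q f with hF
  set G := rootSubst q g with hG
  set Q := Fintype.card (FundCell q)
  have hFG : F * G = (reducedMatrix q V lam).det := by
    rw [← rootSubst_floquetDet hq, hfg, map_mul]
  have hvert : ∀ k (u : ℤˣ), ∃ a b, F.coeff a ≠ 0 ∧ G.coeff b ≠ 0 ∧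
      a + b = Pi.single k ((Q : ℤ) * u) := fun k u =>
    exists_coeff_of_mul (hFG ▸ coeff_det_reducedMatrix_ne_zero hq V lam k u)
  have hQ : 0 < (Q : ℤ) := by
    have : Nonempty (FundCell q) := ⟨fun j => ⟨0, hq j⟩⟩
    exact Int.natCast_pos.2 Fintype.card_pos
  let k : Fin d := ⟨0, by lia⟩
  have hF0 : F ≠ 0 := fun h => by
    obtain ⟨a, b, ha, -⟩ := hvert k 1
    exact ha (by rw [h]; rfl)
  have hG0 : G ≠ 0 := fun h => by
    obtain ⟨a, b, -, hb, -⟩ := hvert k 1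
    exact hb (by rw [h]; rfl)
  have htop : ∀ ε : Fin d → ℤˣ, ∃ m n, WeightLE (signWeight ε) m F ∧ WeightLE (signWeight ε) n G ∧
      m + n = Q ∧ ((∃ a, IsUniqueMax (signWeight ε) F a) ∨ ∃ a, IsUniqueMax (signWeight ε) G a) := by
    intro ε
    obtain ⟨m, hm, hm0⟩ := exists_weight_max (signWeight ε) hF0
    obtain ⟨n, hn, hn0⟩ := exists_weight_max (signWeight ε) hG0
    have hP := weightLE_and_weightPart_det (weightLE_reducedMatrix q V lam ε)
    rw [weightPart_reducedMatrix, det_leadingMatrix hq, ← hFG] at hP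
    have hmul := hm.weightPart_mul hn
    -- The ring is a domain, so the top part of `F * G` sits in weight `m + n`; the weight-`Q` part
    -- of the determinant is a product of primes, hence nonzero, and nothing lies above it.
    have hmn : m + n = Q := by
      apply le_antisymm
      · by_contra! h
        rw [hP.1.weightPart_eq_zero h] at hmul
        exact mul_ne_zero hm0 hn0 hmul.symm
      · by_contra! h
        have h1 := hP.2
        rw [(hm.mul hn).weightPart_eq_zero h] at h1
        exact Finset.prod_ne_zero_iff.2 (fun l _ =>
          (prime_linForm (by lia) (leadingCoeffs_ne_zero q ε l) ε).ne_zero) h1.symm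
    rw [hmn, hP.2] at hmul
    refine ⟨m, n, hm, hn, hmn, ?_⟩
    rcases isUnit_or_isUnit_of_mul_eq (by lia) hq hgcd
      ((latticeSupported_rootSubst q f).weightPart (signWeight ε) m)
      ((latticeSupported_rootSubst q g).weightPart (signWeight ε) n) hmul.symm with h | h
    · exact .inl (h.isLaurentMonomial.exists_isUniqueMax hm)
    · exact .inr (h.isLaurentMonomial.exists_isUniqueMax hn)
  choose m n hm hn hmn hmax using htop
  -- Any single facet decides which factor is the monomial; the all-plus one is used.
  rcases hmax 1 with ⟨a, ha⟩ | ⟨a, ha⟩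
  · refine hf (isLaurentMonomial_of_rootSubst hq (isLaurentMonomial_of_isUniqueMax hd hQ
      (fun ε => (hmax ε).symm) (fun ε => ⟨n ε, m ε, hn ε, hm ε, by rw [add_comm, hmn]⟩)
      (fun k u => ?_) ha))
    obtain ⟨a, b, ha, hb, hab⟩ := hvert k u
    exact ⟨b, a, hb, ha, by rw [add_comm, hab]⟩
  · exact hg (isLaurentMonomial_of_rootSubst hq (isLaurentMonomial_of_isUniqueMax hd hQ hmax
      (fun ε => ⟨m ε, n ε, hm ε, hn ε, hmn ε⟩) hvert ha))
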